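/- Let $n\in\mathbb N$ and let $\mathcal M\subseteq \mathbb M_n(\mathbb C)$ be a unital $*$-subalgebra (containing $I_n$). There are a number $K$, an enumeration $P_1,\dots,P_K$ without repetition of all minimal projections of the centre of $\mathcal M$ (nonzero central projections of $\mathcal M$ that dominate no other nonzero central projection of $\mathcal M$), integers $m_k,\ell_k\ge 1$ with $n_k:=m_k\ell_k=\operatorname{tr}P_k$ and $\sum_{k=1}^K n_k=n$, a unitary matrix $U\in\mathbb M_n(\mathbb C)$, and unital $*$-subalgebras $\mathcal M_k\subseteq\mathbb M_{n_k}(\mathbb C)$ such that $$U\mathcal M U^{\mathsf H}=\bigoplus_{k=1}^K\mathcal M_k ,\qquad \mathcal M_k=\mathbb M_{m_k}(\mathbb C)\otimes\mathbb C[I_{\ell_k}],$$ where each $\mathcal M_k$ is a factor (its centre is $\mathbb C[I_{n_k}]$), is unitarily equivalent to $P_k\mathcal M P_k$ acting on the range of $P_k$, and $UP_kU^{\mathsf H}$ is the block-diagonal matrix with $I_{n_k}$ as its $k$-th block and zeros elsewhere. Here the product basis of $\mathbb C^{m}\otimes\mathbb C^{\ell}$ is numbered so that $A\otimes I_\ell=\operatorname{diag}(A,\dots,A)$.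 Moreover, let $\varphi$ be any normalised state on $\mathcal M$ (a linear functional with $\varphi(A^{\mathsf H}A)\ge 0$, $\varphi(A^{\mathsf H})=\overline{\varphi(A)}$ and $\varphi(I_n)=1$), and let $R\in\mathcal M$ be a density matrix representing it, i.e. $R$ is positive semidefinite, $\operatorname{tr}R=1$ and $\varphi(A)=\operatorname{tr}(RA)$ for all $A\in\mathcal M$. Then, with the same $U$, $$URU^{\mathsf H}=\bigoplus_{k=1}^K R_k ,\qquad R_k=\hat R_{m_k}\otimes\tfrac1{\ell_k}I_{\ell_k}=\tfrac1{\ell_k}\operatorname{diag}(\hat R_{m_k},\dots,\hat R_{m_k}),$$ with positive semidefinite $R_k\in\mathbb M_{n_k}(\mathbb C)$ and $\hat R_{m_k}\in\mathbb M_{m_k}(\mathbb C)$, and for every $k$ $$\alpha_k:=\varphi(P_k)=\operatorname{tr}(RP_k)=\operatorname{tr}(P_kRP_k)=\operatorname{tr}R_k=\operatorname{tr}\hat R_{m_k}.$$ -/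

import Mathlib

open scoped ComplexOrder Kronecker Matrix

namespace MatrixProb

/-- A normalised state on a unital complex `*`-algebra: a positive, Hermitean linear functional
with value one at the unit. -/
structure IsNormalizedState {A : Type*} [Ring A] [StarRing A] [Algebra ℂ A]
    (φ : A →ₗ[ℂ] ℂ) : Prop where
  positive : ∀ a : A, 0 ≤ φ (star a * a)
  hermitean : ∀ a : A, φ (star a) = star (φ a)
  normalized : φ 1 = 1

/-- A (finite dimensional) unital complex algebra is a factor iff its centre consists of the
scalar multiples of the unit. -/
def IsFactor (A : Type*) [Ring A] [Algebra ℂ A] : Prop :=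
  Subalgebra.center ℂ A = ⊥

/-- The density matrices of `M`: the positive semidefinite elements of `M` of unit trace. -/
def densityMatrices {n : ℕ} (M : StarSubalgebra ℂ (Matrix (Fin n) (Fin n) ℂ)) :
    Set (Matrix (Fin n) (Fin n) ℂ) :=
  {R | R ∈ M ∧ R.PosSemidef ∧ R.trace = 1}

/-- `R` represents the functional `φ` on `M`, that is `φ(A) = tr(R A)` for all `A` in `M`. -/
def Represents {n : ℕ} {M : StarSubalgebra ℂ (Matrix (Fin n) (Fin n) ℂ)}
    (R : Matrix (Fin n) (Fin n) ℂ) (φ : M →ₗ[ℂ] ℂ) : Prop :=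
  ∀ A : M, φ A = (R * (A : Matrix (Fin n) (Fin n) ℂ)).trace

/-- A projection in the centre of `M` which is minimal among the nonzero projections of the
centre; the order `q ≤ p` means that `p - q` is positive semidefinite. -/
def IsMinimalCentralProjection {n : ℕ} (M : StarSubalgebra ℂ (Matrix (Fin n) (Fin n) ℂ))
    (p : M) : Prop :=
  IsStarProjection p ∧ p ∈ Subalgebra.center ℂ M ∧ p ≠ 0 ∧
    ∀ q : M, IsStarProjection q → q ∈ Subalgebra.center ℂ M →
      ((p : Matrix (Fin n) (Fin n) ℂ) - (q : Matrix (Fin n) (Fin n) ℂ)).PosSemidef →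
      q = 0 ∨ q = p

/-- The block-diagonal matrix with square diagonal blocks `B 0, B 1, …` in this order. -/
def directSum {K n : ℕ} {N : Fin K → ℕ} (h : ∑ k, N k = n)
    (B : ∀ k, Matrix (Fin (N k)) (Fin (N k)) ℂ) : Matrix (Fin n) (Fin n) ℂ :=
  Matrix.reindex (finSigmaFinEquiv.trans (finCongr h)) (finSigmaFinEquiv.trans (finCongr h))
    (Matrix.blockDiagonal' B)

/-- The numbering of the product basis of `ℂ^m ⊗ ℂ^ℓ` in which the index of the first factor
runs fastest: `(i, a)` has number `i + m * a`. -/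
def tensorIndex (m ℓ : ℕ) : Fin m × Fin ℓ ≃ Fin (m * ℓ) :=
  ((Equiv.prodComm (Fin m) (Fin ℓ)).trans finProdFinEquiv).trans (finCongr (Nat.mul_comm ℓ m))

/-- The Kronecker product `A ⊗ B` as a square matrix of size `m * ℓ`, in the numbering of the
product basis for which `A ⊗ 1` is block-diagonal with `ℓ` identical blocks `A`. -/
def tensor {m ℓ : ℕ} (A : Matrix (Fin m) (Fin m) ℂ) (B : Matrix (Fin ℓ) (Fin ℓ) ℂ) :
    Matrix (Fin (m * ℓ)) (Fin (m * ℓ)) ℂ :=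
  Matrix.reindex (tensorIndex m ℓ) (tensorIndex m ℓ) (A ⊗ₖ B)

theorem sum_const_fin (m ℓ : ℕ) : ∑ _a : Fin ℓ, m = m * ℓ := by
  simp [Nat.mul_comm]

/-- The set `p M p = {p A p | A ∈ M}`. -/
def corner {n : ℕ} (M : StarSubalgebra ℂ (Matrix (Fin n) (Fin n) ℂ))
    (p : Matrix (Fin n) (Fin n) ℂ) : Set (Matrix (Fin n) (Fin n) ℂ) :=
  {X | ∃ A ∈ M, X = p * A * p}

/-- A set `S` of operators on the range of the orthogonal projection `p` (written as matrices `X`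
with `X = p X p`) is unitarily equivalent to a set `T` of operators on `ℂ^d`:
there is a unitary `W` from the range of `p` onto `ℂ^d` (a partial isometry with initial
projection `p` and final projection the identity) such that `T = W S Wᴴ`. -/
def UnitarilyEquivalent {n d : ℕ} (p : Matrix (Fin n) (Fin n) ℂ)
    (S : Set (Matrix (Fin n) (Fin n) ℂ)) (T : Set (Matrix (Fin d) (Fin d) ℂ)) : Prop :=
  ∃ W : Matrix (Fin d) (Fin n) ℂ, Wᴴ * W = p ∧ W * Wᴴ = 1 ∧ T = (fun X => W * X * Wᴴ) '' S

end MatrixProb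

open MatrixProb

/-! The structure comes from cutting the unit of `M` into minimal projections. By finite dimension
there is an orthogonal family of nonzero projections in `M` of largest cardinality. Maximality
forces its sum to be `1` and forbids splitting a member (`exists_minimal_family`); spectral
projections turn the absence of proper subprojections into `e M e = ℂ e`. For minimal `e` and `f`, a
nonzero element of `e M f` is a scalar multiple of a partial isometry (`ProjEquiv.of_ne_zero`), so
members in different equivalence classes do not interact. The classes are the blocks: `m k` counts
the members of a class and `l k` is their common rank. Carrying one orthonormal basis of a
representative's range to the other members gives a basis of the whole space in which `M` is exactly
the direct sum of the algebras of matrices `B k ⊗ 1` (`exists_unitary_of_isometries`).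

The rest is read off from this form. A central projection is `0` or `1` on each block, so the
minimal ones are the block units (`isMinimalCentralProjection_iff`). A density matrix lies in `M`,
hence has blocks `B k ⊗ 1`; moving the factor `l k` between the tensor legs gives the normalised
form, and pairing with a block unit gives the trace of that block. -/

namespace MatrixProb

/-! ### Spectral projections, minimal projections and orthogonal families. -/

section Projections

variable {ι : Type*} [Fintype ι] [DecidableEq ι]

/-- A nonzero Hermitean element of a `*`-algebra of matrices has a nonzero eigenvalue whose
spectral projection belongs to the algebra. -/
theorem exists_spectral_projection (M : StarSubalgebra ℂ (Matrix ι ι ℂ)) {X : Matrix ι ι ℂ}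
    (hXM : X ∈ M) (hX : X.IsHermitian) (hX0 : X ≠ 0) :
    ∃ c : ℂ, c ≠ 0 ∧ ∃ q ∈ M, IsStarProjection q ∧ q ≠ 0 ∧ X * q = c • q := by
  obtain ⟨i, hi⟩ : ∃ i, hX.eigenvalues i ≠ 0 := by
    by_contra! h
    exact hX0 (hX.eigenvalues_eq_zero_iff.1 (funext h))
  set c := hX.eigenvalues i with hc
  have hmem : c ∈ spectrum ℝ X := hX.eigenvalues_mem_spectrum_real i
  have hfin : (spectrum ℝ X).Finite := Matrix.finite_real_spectrum
  have hsa : IsSelfAdjoint X := hX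
  have hcont (f : ℝ → ℝ) : ContinuousOn f (spectrum ℝ X) := hfin.continuousOn f
  -- The indicator of one eigenvalue is continuous on the finite spectrum, so `cfc f X` is its
  -- spectral projection.
  let f : ℝ → ℝ := fun t => if t = c then 1 else 0
  have hclosed : IsClosed (M : Set (Matrix ι ι ℂ)) :=
    Submodule.closed_of_finiteDimensional (Subalgebra.toSubmodule M.toSubalgebra)
  refine ⟨(c : ℂ), by exact_mod_cast hi, cfc f X, ?_, ⟨?_, cfc_predicate f X⟩, ?_, ?_⟩
  · exact cfc_mem (𝕜' := ℂ) (hs := hclosed) f hXM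
  · rw [IsIdempotentElem, ← cfc_mul f f X (hcont f) (hcont f)]
    congr 1
    ext t
    simp [f]
  · intro h0
    have := (cfc_map_spectrum f X hsa (hcont f))
    have h1 : f c ∈ spectrum ℝ (cfc f X) := by
      rw [this]
      exact ⟨c, hmem, rfl⟩
    rw [h0] at h1
    have : Nontrivial (Matrix ι ι ℂ) := ⟨X, 0, hX0⟩
    simp [f] at h1
  · have h1 : X * cfc f X = cfc (fun t => t * f t) X := by
      rw [cfc_mul (fun t => t) f X (hcont _) (hcont _), cfc_id' ℝ X]
    have h2 : (fun t => t * f t) = fun t => c * f t := by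
      ext t
      by_cases h : t = c <;> simp [f, h]
    rw [h1, h2, cfc_const_mul c f X (hcont _)]
    ext a b
    simp

/-- A projection `e` of `M` is minimal if `e M e` consists of the multiples of `e`. -/
structure IsMinimalProjection (M : StarSubalgebra ℂ (Matrix ι ι ℂ)) (e : Matrix ι ι ℂ) :
    Prop where
  mem : e ∈ M
  proj : IsStarProjection e
  ne_zero : e ≠ 0
  corner : ∀ A ∈ M, ∃ c : ℂ, e * A * e = c • e

/-- A Hermitian element of `e M e` has a spectral projection for a nonzero eigenvalue, which lies
below `e` and so equals `e`; hence the element is a multiple of `e`. Splitting into real and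
imaginary parts covers the whole corner. -/
theorem isMinimalProjection_of_forall {M : StarSubalgebra ℂ (Matrix ι ι ℂ)} {e : Matrix ι ι ℂ}
    (he : e ∈ M) (hp : IsStarProjection e) (h0 : e ≠ 0)
    (h : ∀ q ∈ M, IsStarProjection q → e * q = q → q ≠ 0 → q = e) :
    IsMinimalProjection M e := by
  have hee : e * e = e := hp.isIdempotentElem
  have hes : eᴴ = e := hp.isSelfAdjoint
  have key : ∀ X ∈ M, X.IsHermitian → e * X = X → ∃ c : ℂ, X = c • e := by
    intro X hXM hX heX
    by_cases hX0 : X = 0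
    · exact ⟨0, by simp [hX0]⟩
    obtain ⟨c, hc, q, hqM, hq, hq0, hXq⟩ := exists_spectral_projection M hXM hX hX0
    have heq : e * q = q := by
      have h1 : q = c⁻¹ • (X * q) := by rw [hXq, smul_smul, inv_mul_cancel₀ hc, one_smul]
      rw [h1, mul_smul_comm, ← mul_assoc, heX]
    have hqe := h q hqM hq heq hq0
    have hXe : X * e = X := by
      have := congrArg Matrix.conjTranspose heX
      rwa [Matrix.conjTranspose_mul, hX.eq, hes] at this
    exact ⟨c, by rw [← hXe, ← hqe, hXq]⟩
  refine ⟨he, hp, h0, fun A hA => ?_⟩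
  have hAs : Aᴴ ∈ M := star_mem hA
  obtain ⟨a, ha⟩ := key (e * (A + Aᴴ) * e) (mul_mem (mul_mem he (add_mem hA hAs)) he)
    (by simp [Matrix.IsHermitian, hes, mul_assoc, add_comm]) (by simp [← mul_assoc, hee])
  obtain ⟨b, hb⟩ := key (e * (Complex.I • (A - Aᴴ)) * e)
    (mul_mem (mul_mem he (M.smul_mem (sub_mem hA hAs) _)) he)
    (by
      simp only [Matrix.IsHermitian, Matrix.conjTranspose_mul, Matrix.conjTranspose_smul,
        Matrix.conjTranspose_sub, Matrix.conjTranspose_conjTranspose, hes, mul_assoc,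
        Complex.star_def, Complex.conj_I]
      rw [neg_smul, ← smul_neg, neg_sub])
    (by simp [← mul_assoc, hee])
  refine ⟨(a - Complex.I * b) / 2, ?_⟩
  have hA2 : A = (2⁻¹ : ℂ) • ((A + Aᴴ) - Complex.I • (Complex.I • (A - Aᴴ))) := by
    rw [smul_smul, Complex.I_mul_I]
    module
  rw [hA2, mul_smul_comm, mul_sub, mul_smul_comm, smul_mul_assoc, sub_mul, smul_mul_assoc, ha, hb]
  module

/-- A finite family of nonzero, mutually orthogonal projections of `M`. -/
structure IsOrthogonalFamily (M : StarSubalgebra ℂ (Matrix ι ι ℂ)) (S : Finset (Matrix ι ι ℂ)) :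
    Prop where
  mem : ∀ e ∈ S, e ∈ M
  proj : ∀ e ∈ S, IsStarProjection e
  ne_zero : ∀ e ∈ S, e ≠ 0
  orthogonal : ∀ e ∈ S, ∀ f ∈ S, e ≠ f → e * f = 0

/-- Nonzero orthogonal idempotents are linearly independent. The bound is what makes a family of
maximal cardinality available. -/
theorem IsOrthogonalFamily.card_le {M : StarSubalgebra ℂ (Matrix ι ι ℂ)}
    {S : Finset (Matrix ι ι ℂ)} (hS : IsOrthogonalFamily M S) :
    S.card ≤ Module.finrank ℂ (Matrix ι ι ℂ) := by
  have hli : LinearIndependent ℂ (fun e : S => (e : Matrix ι ι ℂ)) := by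
    rw [Fintype.linearIndependent_iff]
    intro g hg e
    have h1 := congrArg (fun X => (e : Matrix ι ι ℂ) * X) hg
    simp only [Finset.mul_sum, mul_zero, mul_smul_comm] at h1
    rw [Finset.sum_eq_single e] at h1
    · rw [(hS.proj e e.2).isIdempotentElem.eq] at h1
      exact (smul_eq_zero.1 h1).resolve_right (hS.ne_zero e e.2)
    · intro f _ hf
      rw [hS.orthogonal e e.2 f f.2 (fun h => hf (Subtype.ext h.symm)), smul_zero]
    · simp
  simpa using hli.fintype_card_le_finrank

theorem IsOrthogonalFamily.insert {M : StarSubalgebra ℂ (Matrix ι ι ℂ)}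
    {S : Finset (Matrix ι ι ℂ)} (hS : IsOrthogonalFamily M S) {q : Matrix ι ι ℂ} (hq : q ∈ M)
    (hqp : IsStarProjection q) (hq0 : q ≠ 0) (h : ∀ e ∈ S, e * q = 0) :
    q ∉ S ∧ IsOrthogonalFamily M (insert q S) := by
  have h' : ∀ e ∈ S, q * e = 0 := by
    intro e he
    have := congrArg star (h e he)
    rwa [star_mul, hqp.isSelfAdjoint.star_eq, (hS.proj e he).isSelfAdjoint.star_eq,
      star_zero] at this
  refine ⟨fun hqS => hq0 ?_, ⟨?_, ?_, ?_, ?_⟩⟩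
  · rw [← h q hqS, hqp.isIdempotentElem.eq]
  · simpa [hq] using hS.mem
  · simpa [hqp] using hS.proj
  · simpa [hq0] using hS.ne_zero
  · intro e he f hf hef
    rcases Finset.mem_insert.1 he with he' | he' <;>
      rcases Finset.mem_insert.1 hf with hf' | hf'
    · exact absurd (he'.trans hf'.symm) hef
    · exact he' ▸ h' f hf'
    · exact hf' ▸ h e he'
    · exact hS.orthogonal e he' f hf' hef

theorem IsOrthogonalFamily.mono {M : StarSubalgebra ℂ (Matrix ι ι ℂ)}
    {S T : Finset (Matrix ι ι ℂ)} (hS : IsOrthogonalFamily M S) (hTS : T ⊆ S) :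
    IsOrthogonalFamily M T :=
  ⟨fun e he => hS.mem e (hTS he), fun e he => hS.proj e (hTS he),
    fun e he => hS.ne_zero e (hTS he),
    fun e he f hf => hS.orthogonal e (hTS he) f (hTS hf)⟩

/-- The unit of a `*`-algebra of matrices is a sum of mutually orthogonal minimal projections. -/
theorem exists_minimal_family (M : StarSubalgebra ℂ (Matrix ι ι ℂ)) :
    ∃ S : Finset (Matrix ι ι ℂ), (∀ e ∈ S, IsMinimalProjection M e) ∧
      (∀ e ∈ S, ∀ f ∈ S, e ≠ f → e * f = 0) ∧ ∑ e ∈ S, e = 1 := by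
  obtain ⟨S, hS, hmax⟩ : ∃ S, IsOrthogonalFamily M S ∧
      ∀ T, IsOrthogonalFamily M T → T.card ≤ S.card := by
    have hne : {d | ∃ S, IsOrthogonalFamily M S ∧ S.card = d}.Nonempty :=
      ⟨0, ∅, ⟨by simp, by simp, by simp, by simp⟩, rfl⟩
    have hbdd : BddAbove {d | ∃ S, IsOrthogonalFamily M S ∧ S.card = d} :=
      ⟨_, fun d ⟨S, hS, hd⟩ => hd ▸ hS.card_le⟩
    obtain ⟨S, hS, hc⟩ := Nat.sSup_mem hne hbdd
    exact ⟨S, hS, fun T hT => hc ▸ le_csSup hbdd ⟨T, hT, rfl⟩⟩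
  have hmul (e) (he : e ∈ S) : e * ∑ f ∈ S, f = e := by
    rw [Finset.mul_sum, Finset.sum_eq_single e]
    · exact (hS.proj e he).isIdempotentElem
    · exact fun f hf hfe => hS.orthogonal e he f hf hfe.symm
    · exact fun h => absurd he h
  refine ⟨S, fun e he => ?_, hS.orthogonal, ?_⟩
  · refine isMinimalProjection_of_forall (hS.mem e he) (hS.proj e he) (hS.ne_zero e he) ?_
    -- If `q` were a proper subprojection, replacing `e` by the pair `q`, `e - q` would give a
    -- larger orthogonal family.
    intro q hqM hq heq hq0
    by_contra hqe
    have hsub : IsStarProjection (e - q) := hq.sub_of_mul_eq_right (hS.proj e he) heq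
    have hR := hS.mono (S.erase_subset e)
    have hfe (f) (hf : f ∈ S.erase e) : f * e = 0 :=
      hS.orthogonal f (Finset.mem_of_mem_erase hf) e he (Finset.ne_of_mem_erase hf)
    have hfq (f) (hf : f ∈ S.erase e) : f * q = 0 := by
      rw [← heq, ← mul_assoc, hfe f hf, zero_mul]
    obtain ⟨hn1, h1⟩ := hR.insert hqM hq hq0 hfq
    have hqe' : q * e = q := by
      have := congrArg star heq
      rwa [star_mul, hq.isSelfAdjoint.star_eq, (hS.proj e he).isSelfAdjoint.star_eq] at this
    obtain ⟨hn2, h2⟩ := h1.insert (sub_mem (hS.mem e he) hqM) hsub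
      (sub_ne_zero.2 (Ne.symm hqe)) (by
        intro f hf
        rcases Finset.mem_insert.1 hf with rfl | hf
        · rw [mul_sub, hqe', hq.isIdempotentElem.eq, sub_self]
        · rw [mul_sub, hfe f hf, hfq f hf, sub_self])
    have h3 := hmax _ h2
    rw [Finset.card_insert_of_notMem hn2, Finset.card_insert_of_notMem hn1,
      Finset.card_erase_of_mem he] at h3
    omega
  -- Otherwise the complement `1 - ∑ e` could be added to the family.
  · by_contra hne
    have hp : IsStarProjection (∑ e ∈ S, e) := by
      refine ⟨?_, ?_⟩
      · rw [IsIdempotentElem, Finset.sum_mul]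
        exact Finset.sum_congr rfl hmul
      · rw [IsSelfAdjoint, star_sum]
        exact Finset.sum_congr rfl fun e he => (hS.proj e he).isSelfAdjoint
    obtain ⟨hn, h⟩ := hS.insert (sub_mem (one_mem M) (sum_mem hS.mem)) hp.one_sub
      (sub_ne_zero.2 (Ne.symm hne)) (fun e he => by rw [mul_sub, hmul e he, mul_one, sub_self])
    have h3 := hmax _ h
    rw [Finset.card_insert_of_notMem hn] at h3
    omega

end Projections

/-! ### Equivalence of minimal projections, matrix units and block-diagonalisation. -/

section Structure

variable {ι : Type*} [Fintype ι] [DecidableEq ι]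

/-- Murray–von Neumann equivalence of the projections `e` and `f` in `M`. -/
def ProjEquiv (M : StarSubalgebra ℂ (Matrix ι ι ℂ)) (e f : Matrix ι ι ℂ) : Prop :=
  ∃ v ∈ M, v * vᴴ = e ∧ vᴴ * v = f ∧ e * v = v ∧ v * f = v

theorem ProjEquiv.refl {M : StarSubalgebra ℂ (Matrix ι ι ℂ)} {e : Matrix ι ι ℂ}
    (he : IsMinimalProjection M e) : ProjEquiv M e e := by
  have hs : eᴴ = e := he.proj.isSelfAdjoint
  have hi : e * e = e := he.proj.isIdempotentElem
  exact ⟨e, he.mem, by rw [hs, hi], by rw [hs, hi], hi, hi⟩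

theorem ProjEquiv.symm {M : StarSubalgebra ℂ (Matrix ι ι ℂ)} {e f : Matrix ι ι ℂ}
    (h : ProjEquiv M e f) : ProjEquiv M f e := by
  obtain ⟨v, hv, h1, h2, h3, h4⟩ := h
  have hes : eᴴ = e := by rw [← h1, Matrix.conjTranspose_mul, Matrix.conjTranspose_conjTranspose]
  have hfs : fᴴ = f := by rw [← h2, Matrix.conjTranspose_mul, Matrix.conjTranspose_conjTranspose]
  refine ⟨vᴴ, star_mem hv, by simpa using h2, by simpa using h1, ?_, ?_⟩
  · simpa only [Matrix.conjTranspose_mul, hfs] using congrArg Matrix.conjTranspose h4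
  · simpa only [Matrix.conjTranspose_mul, hes] using congrArg Matrix.conjTranspose h3

theorem ProjEquiv.trans {M : StarSubalgebra ℂ (Matrix ι ι ℂ)} {e f g : Matrix ι ι ℂ}
    (h : ProjEquiv M e f) (h' : ProjEquiv M f g) : ProjEquiv M e g := by
  obtain ⟨v, hv, h1, h2, h3, h4⟩ := h
  obtain ⟨w, hw, k1, k2, k3, k4⟩ := h'
  refine ⟨v * w, mul_mem hv hw, ?_, ?_, ?_, ?_⟩
  · rw [Matrix.conjTranspose_mul, mul_assoc, ← mul_assoc w, k1, ← mul_assoc, h4, h1]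
  · rw [Matrix.conjTranspose_mul, mul_assoc, ← mul_assoc vᴴ, h2, k3, k2]
  · rw [← mul_assoc, h3]
  · rw [mul_assoc, k4]

/-- Minimal projections connected by a nonzero element of `M` are equivalent. -/
theorem ProjEquiv.of_ne_zero {M : StarSubalgebra ℂ (Matrix ι ι ℂ)} {e f A : Matrix ι ι ℂ}
    (he : IsMinimalProjection M e) (hf : IsMinimalProjection M f) (hA : A ∈ M)
    (h : e * A * f ≠ 0) : ProjEquiv M e f := by
  have hes : eᴴ = e := he.proj.isSelfAdjoint
  have hei : e * e = e := he.proj.isIdempotentElem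
  have hfs : fᴴ = f := hf.proj.isSelfAdjoint
  have hfi : f * f = f := hf.proj.isIdempotentElem
  set X := e * A * f with hX
  have hXM : X ∈ M := mul_mem (mul_mem he.mem hA) hf.mem
  have heX : e * X = X := by rw [hX, ← mul_assoc, ← mul_assoc, hei]
  have hXf : X * f = X := by rw [hX, mul_assoc, hfi]
  have hXe : Xᴴ * e = Xᴴ := by
    have := congrArg Matrix.conjTranspose heX
    rwa [Matrix.conjTranspose_mul, hes] at this
  have hfX : f * Xᴴ = Xᴴ := by
    have := congrArg Matrix.conjTranspose hXf
    rwa [Matrix.conjTranspose_mul, hfs] at this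
  obtain ⟨c, hc⟩ := he.corner (X * Xᴴ) (mul_mem hXM (star_mem hXM))
  obtain ⟨d, hd⟩ := hf.corner (Xᴴ * X) (mul_mem (star_mem hXM) hXM)
  rw [← mul_assoc, heX, mul_assoc, hXe] at hc
  rw [← mul_assoc, hfX, mul_assoc, hXf] at hd
  -- Both constants appear on evaluating `X * Xᴴ * X` in two ways, and `X` is nonzero.
  have hcd : c = d := by
    have h1 : c • X = d • X := by
      rw [← heX, ← smul_mul_assoc, ← hc, heX, mul_assoc, hd, mul_smul_comm, hXf]
    exact smul_left_injective ℂ h h1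
  subst hcd
  have hpos : 0 ≤ c := by
    have h1 : (X * Xᴴ).trace = c * (e * eᴴ).trace := by
      rw [hc, Matrix.trace_smul, hes, hei, smul_eq_mul]
    have h2 : 0 ≤ (X * Xᴴ).trace := (Matrix.posSemidef_self_mul_conjTranspose X).trace_nonneg
    have h3 : 0 ≤ (e * eᴴ).trace := (Matrix.posSemidef_self_mul_conjTranspose e).trace_nonneg
    have h4 : (e * eᴴ).trace ≠ 0 := fun h0 =>
      he.ne_zero (Matrix.trace_mul_conjTranspose_self_eq_zero_iff.1 h0)
    have h5 : c = (X * Xᴴ).trace * ((e * eᴴ).trace)⁻¹ := by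
      rw [h1, mul_assoc, mul_inv_cancel₀ h4, mul_one]
    rw [h5]
    exact mul_nonneg h2 (inv_nonneg_of_nonneg h3)
  have hc0 : c ≠ 0 := by
    rintro rfl
    rw [zero_smul] at hc
    exact h (Matrix.self_mul_conjTranspose_eq_zero.1 hc)
  obtain ⟨r, hr, rfl⟩ : ∃ r : ℝ, 0 ≤ r ∧ (r : ℂ) = c := by
    rw [Complex.nonneg_iff] at hpos
    exact ⟨c.re, hpos.1, Complex.ext rfl (by simpa using hpos.2)⟩
  have hr0 : r ≠ 0 := by exact_mod_cast hc0
  -- Since `X * Xᴴ = r • e` and `Xᴴ * X = r • f`, scaling by `r^(-1/2)` makes `X` a partial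
  -- isometry.
  set s : ℂ := (((Real.sqrt r)⁻¹ : ℝ) : ℂ) with hs
  have hstar : star s = s := Complex.conj_ofReal _
  have hss : s * s * (r : ℂ) = 1 := by
    rw [hs, ← Complex.ofReal_mul, ← Complex.ofReal_mul, ← mul_inv, Real.mul_self_sqrt hr,
      inv_mul_cancel₀ hr0, Complex.ofReal_one]
  refine ⟨s • X, M.smul_mem hXM s, ?_, ?_, ?_, ?_⟩
  · rw [Matrix.conjTranspose_smul, hstar, smul_mul_smul_comm, hc, smul_smul, hss, one_smul]
  · rw [Matrix.conjTranspose_smul, hstar, smul_mul_smul_comm, hd, smul_smul, hss, one_smul]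
  · rw [mul_smul_comm, heX]
  · rw [smul_mul_assoc, hXf]

/-- The range of a projection has an orthonormal basis. -/
theorem exists_isometry_of_isStarProjection {e : Matrix ι ι ℂ} (he : IsStarProjection e) :
    ∃ (l : ℕ) (F : Matrix ι (Fin l) ℂ), F * Fᴴ = e ∧ Fᴴ * F = 1 := by
  have hH : e.IsHermitian := he.isSelfAdjoint
  set U : Matrix ι ι ℂ := (hH.eigenvectorUnitary : Matrix ι ι ℂ)
  have hUU : Uᴴ * U = 1 := Unitary.coe_star_mul_self hH.eigenvectorUnitary
  have hspec : e = U * Matrix.diagonal (fun i => (hH.eigenvalues i : ℂ)) * Uᴴ := by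
    conv_lhs => rw [hH.spectral_theorem, Unitary.conjStarAlgAut_apply]
    rfl
  have hval : ∀ i, hH.eigenvalues i = 0 ∨ hH.eigenvalues i = 1 := by
    have h1 : Uᴴ * e * U = Matrix.diagonal (fun i => (hH.eigenvalues i : ℂ)) := by
      conv_lhs => rw [hspec]
      rw [mul_assoc, mul_assoc, mul_assoc, hUU, mul_one, ← mul_assoc, hUU, one_mul]
    have h2 : (Uᴴ * e * U) * (Uᴴ * e * U) = Uᴴ * e * U := by
      have h3 : U * Uᴴ = 1 := Unitary.coe_mul_star_self hH.eigenvectorUnitary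
      calc _ = Uᴴ * e * (U * Uᴴ) * e * U := by simp only [mul_assoc]
        _ = Uᴴ * (e * e) * U := by rw [h3, mul_one, mul_assoc Uᴴ e e]
        _ = _ := by rw [he.isIdempotentElem.eq]
    rw [h1, Matrix.diagonal_mul_diagonal] at h2
    intro i
    have h4 := congrFun (Matrix.diagonal_injective h2) i
    have h5 : hH.eigenvalues i * hH.eigenvalues i = hH.eigenvalues i := by exact_mod_cast h4
    rcases eq_or_ne (hH.eigenvalues i) 0 with h | h
    · exact Or.inl h
    · exact Or.inr (mul_right_cancel₀ h (by rw [h5, one_mul]))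
  -- The eigenvalues are `0` or `1`, so the eigenvectors for `1` are the required basis.
  let E := Fintype.equivFin {i // hH.eigenvalues i = 1}
  refine ⟨_, U.submatrix id (fun a => (E.symm a : ι)), ?_, ?_⟩
  · conv_rhs => rw [hspec]
    ext x y
    rw [Matrix.mul_apply, Matrix.mul_apply]
    simp only [Matrix.mul_diagonal, Matrix.submatrix_apply, id, Matrix.conjTranspose_apply]
    rw [E.symm.sum_comp (fun i : {i // hH.eigenvalues i = 1} => U x i * star (U y i)),
      ← Finset.sum_subtype (Finset.univ.filter fun i => hH.eigenvalues i = 1) (by simp)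
        (fun i => U x i * star (U y i)), Finset.sum_filter]
    refine Finset.sum_congr rfl fun i _ => ?_
    rcases hval i with h | h <;> simp [h]
  · rw [Matrix.conjTranspose_submatrix, ← Matrix.submatrix_mul _ _ _ _ _ Function.bijective_id, hUU]
    exact Matrix.submatrix_one _ (Subtype.val_injective.comp E.symm.injective)

/-- A complete system of matrix units, given through isometries `W k i`, block-diagonalizes a
`*`-algebra of matrices. -/
theorem exists_unitary_of_isometries (M : StarSubalgebra ℂ (Matrix ι ι ℂ)) {K : ℕ}
    {m l : Fin K → ℕ} (W : ∀ k, Fin (m k) → Matrix ι (Fin (l k)) ℂ)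
    (h1 : ∀ k i, (W k i)ᴴ * W k i = 1)
    (h2 : ∀ k i j, i ≠ j → (W k i)ᴴ * W k j = 0)
    (h3 : ∀ k k', k ≠ k' → ∀ i j, ∀ A ∈ M, (W k i)ᴴ * A * W k' j = 0)
    (h4 : ∀ k i j, ∀ A ∈ M, ∃ c : ℂ, (W k i)ᴴ * A * W k j = c • 1)
    (h5 : ∀ k i j, W k i * (W k j)ᴴ ∈ M)
    (h6 : ∑ k, ∑ i, W k i * (W k i)ᴴ = 1) :
    ∃ V : Matrix ι (Σ k, Fin (m k) × Fin (l k)) ℂ, Vᴴ * V = 1 ∧ V * Vᴴ = 1 ∧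
      ∀ A, A ∈ M ↔ ∃ B : ∀ k, Matrix (Fin (m k)) (Fin (m k)) ℂ,
        Vᴴ * A * V = Matrix.blockDiagonal' fun k =>
          B k ⊗ₖ (1 : Matrix (Fin (l k)) (Fin (l k)) ℂ) := by
  -- The isometries `W k i` placed side by side: the blocks of `Vᴴ * A * V` are the products `(W k
  -- i)ᴴ * A * W k' j`.
  let V : Matrix ι (Σ k, Fin (m k) × Fin (l k)) ℂ :=
    Matrix.of fun x s => W s.1 s.2.1 x s.2.2
  have hV (A : Matrix ι ι ℂ) (s t) :
      (Vᴴ * A * V) s t = ((W s.1 s.2.1)ᴴ * A * W t.1 t.2.1) s.2.2 t.2.2 := by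
    simp [Matrix.mul_apply, V]
  have hVV : V * Vᴴ = 1 := by
    rw [← h6]
    ext x y
    simp only [Matrix.mul_apply, Matrix.sum_apply, Fintype.sum_sigma, Fintype.sum_prod_type]
    rfl
  have hVV' : Vᴴ * V = 1 := by
    rw [← Matrix.mul_one Vᴴ]
    ext ⟨k, i, a⟩ ⟨k', j, b⟩
    rw [hV]
    by_cases hk : k = k'
    · subst hk
      rw [Matrix.mul_one]
      by_cases hi : i = j
      · subst hi
        simp [h1, Matrix.one_apply]
      · simp [h2 k i j hi, hi]
    · rw [h3 k k' hk i j 1 (one_mem M)]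
      simp [hk]
  refine ⟨V, hVV', hVV, fun A => ⟨fun hA => ?_, ?_⟩⟩
  · choose B hB using fun k i j => h4 k i j A hA
    refine ⟨fun k => Matrix.of (B k), ?_⟩
    ext ⟨k, i, a⟩ ⟨k', j, b⟩
    rw [hV]
    by_cases hk : k = k'
    · subst hk
      rw [Matrix.blockDiagonal'_apply_eq, hB]
      simp [Matrix.kroneckerMap_apply]
    · rw [Matrix.blockDiagonal'_apply_ne _ _ _ hk, h3 k k' hk i j A hA]
      rfl
  · rintro ⟨B, hB⟩
    -- The products `W k i * (W k j)ᴴ` are matrix units lying in `M`, so expanding `A` in them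
    -- proves membership.
    have hA : A = ∑ k, ∑ i, ∑ j, B k i j • (W k i * (W k j)ᴴ) := by
      have h7 : A = V * (Vᴴ * A * V) * Vᴴ := by
        calc A = (V * Vᴴ) * A * (V * Vᴴ) := by rw [hVV, one_mul, mul_one]
          _ = _ := by simp only [Matrix.mul_assoc]
      rw [h7, hB]
      have h8 (x k j b) : (V * Matrix.blockDiagonal' fun k =>
          B k ⊗ₖ (1 : Matrix (Fin (l k)) (Fin (l k)) ℂ)) x ⟨k, j, b⟩ =
            ∑ i, W k i x b * B k i j := by
        rw [Matrix.mul_apply, Fintype.sum_sigma, Finset.sum_eq_single k]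
        · simp [Fintype.sum_prod_type, Matrix.kroneckerMap_apply, Matrix.one_apply, V]
        · intro k' _ hk
          exact Finset.sum_eq_zero fun t _ => by
            rw [Matrix.blockDiagonal'_apply_ne _ _ _ hk, mul_zero]
        · simp
      ext x y
      rw [Matrix.mul_apply, Fintype.sum_sigma]
      simp only [Matrix.sum_apply]
      refine Finset.sum_congr rfl fun k _ => ?_
      rw [Finset.sum_comm, Fintype.sum_prod_type]
      refine Finset.sum_congr rfl fun j _ => ?_
      simp only [h8, Matrix.smul_apply, Matrix.mul_apply, Finset.sum_mul, smul_eq_mul,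
        Finset.mul_sum]
      rw [Finset.sum_comm]
      refine Finset.sum_congr rfl fun i _ => Finset.sum_congr rfl fun b _ => ?_
      simp only [Matrix.conjTranspose_apply, V, Matrix.of_apply]
      ring
    rw [hA]
    exact sum_mem fun k _ => sum_mem fun i _ => sum_mem fun j _ => M.smul_mem (h5 k i j) _

/-- The structure theorem for `*`-algebras of matrices: after a change of orthonormal basis, `M`
is the direct sum of full matrix algebras with multiplicities. -/
theorem exists_unitary_blockDiagonal (M : StarSubalgebra ℂ (Matrix ι ι ℂ)) :
    ∃ (K : ℕ) (m l : Fin K → ℕ) (V : Matrix ι (Σ k, Fin (m k) × Fin (l k)) ℂ),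
      (∀ k, 0 < m k) ∧ (∀ k, 0 < l k) ∧ Vᴴ * V = 1 ∧ V * Vᴴ = 1 ∧
      ∀ A, A ∈ M ↔ ∃ B : ∀ k, Matrix (Fin (m k)) (Fin (m k)) ℂ,
        Vᴴ * A * V = Matrix.blockDiagonal' fun k =>
          B k ⊗ₖ (1 : Matrix (Fin (l k)) (Fin (l k)) ℂ) := by
  classical
  obtain ⟨S, hmin, horth, hsum⟩ := exists_minimal_family M
  let r : Setoid S :=
    { r := fun e f => ProjEquiv M e f
      iseqv := ⟨fun e => ProjEquiv.refl (hmin e e.2), ProjEquiv.symm, ProjEquiv.trans⟩ }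
  let q : Fin (Fintype.card (Quotient r)) ≃ Quotient r := (Fintype.equivFin _).symm
  -- Blocks are equivalence classes `q k`; `g k` numbers the members of a class, whose count becomes
  -- `m k`.
  let g (k) := (Fintype.equivFin {e : S // (Quotient.mk r e) = q k}).symm
  have hg (k i) : ProjEquiv M (g k i : S) (q k).out := by
    have h : Quotient.mk r (g k i : S) = Quotient.mk r (q k).out :=
      (g k i).2.trans (q k).out_eq.symm
    exact Quotient.exact h
  have hneg (k i k' j) (hk : k ≠ k') (A) (hA : A ∈ M) :
      ((g k i : S) : Matrix ι ι ℂ) * A * ((g k' j : S) : Matrix ι ι ℂ) = 0 := by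
    by_contra h0
    have h1 : ProjEquiv M (g k i : S) (g k' j : S) :=
      ProjEquiv.of_ne_zero (hmin _ (g k i : S).2) (hmin _ (g k' j : S).2) hA h0
    have h2 : Quotient.mk r (g k i : S) = Quotient.mk r (g k' j : S) := Quotient.sound h1
    exact hk (q.injective (by rw [← (g k i).2, ← (g k' j).2, h2]))
  choose v hvM hv1 hv2 hv3 hv4 using hg
  have hrep (k) : IsMinimalProjection M ((q k).out : S) := hmin _ (q k).out.2
  choose l F hF1 hF2 using fun k => exists_isometry_of_isStarProjection (hrep k).proj
  -- One basis `F k` of the representative's range serves the whole class; this shared choice makes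
  -- the blocks scalar.
  let W (k i) : Matrix ι (Fin (l k)) ℂ := v k i * F k
  have hWW (k i) : W k i * (W k i)ᴴ = (g k i : S) := by
    rw [Matrix.conjTranspose_mul, Matrix.mul_assoc, ← Matrix.mul_assoc (F k), hF1,
      ← Matrix.mul_assoc, hv4, hv1]
  have h1 (k i) : (W k i)ᴴ * W k i = 1 := by
    rw [Matrix.conjTranspose_mul, Matrix.mul_assoc, ← Matrix.mul_assoc (v k i)ᴴ, hv2, ← hF1,
      Matrix.mul_assoc, hF2, Matrix.mul_one, hF2]
  have hWl (k i) : ((g k i : S) : Matrix ι ι ℂ) * W k i = W k i := by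
    rw [← Matrix.mul_assoc, hv3]
  have hWr (k i) : (W k i)ᴴ * ((g k i : S) : Matrix ι ι ℂ) = (W k i)ᴴ := by
    rw [← hWW, ← Matrix.mul_assoc, h1, Matrix.one_mul]
  have hins (k i k' j) (A : Matrix ι ι ℂ) : (W k i)ᴴ * A * W k' j =
      (W k i)ᴴ * (((g k i : S) : Matrix ι ι ℂ) * A * ((g k' j : S) : Matrix ι ι ℂ)) * W k' j := by
    conv_lhs => rw [← hWl k' j, ← hWr k i]
    simp only [Matrix.mul_assoc]
  refine (exists_unitary_of_isometries M W h1 ?_ ?_ ?_ ?_ ?_).elim fun V hV => ?_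
  · intro k i j hij
    have h0 := hins k i k j 1
    rw [Matrix.mul_one, Matrix.mul_one, horth _ (g k i : S).2 _ (g k j : S).2
      (fun h => hij ((g k).injective (Subtype.ext (Subtype.ext h))))] at h0
    simpa using h0
  · intro k k' hk i j A hA
    rw [hins, hneg k i k' j hk A hA, Matrix.mul_zero, Matrix.zero_mul]
  · intro k i j A hA
    -- Pulled back to the representative, `A` is compressed to its corner, which is scalar by
    -- minimality.
    obtain ⟨c, hc⟩ := (hrep k).corner ((v k i)ᴴ * A * v k j)
      (mul_mem (mul_mem (star_mem (hvM k i)) hA) (hvM k j))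
    refine ⟨c, ?_⟩
    have hFl : (((q k).out : S) : Matrix ι ι ℂ) * F k = F k := by
      rw [← hF1, Matrix.mul_assoc, hF2, Matrix.mul_one]
    have hFr : (F k)ᴴ * (((q k).out : S) : Matrix ι ι ℂ) = (F k)ᴴ := by
      rw [← hF1, ← Matrix.mul_assoc, hF2, Matrix.one_mul]
    calc (W k i)ᴴ * A * W k j = (F k)ᴴ * ((v k i)ᴴ * A * v k j) * F k := by
          simp only [W, Matrix.conjTranspose_mul, Matrix.mul_assoc]
      _ = (F k)ᴴ * ((((q k).out : S) : Matrix ι ι ℂ) * ((v k i)ᴴ * A * v k j) *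
            (((q k).out : S) : Matrix ι ι ℂ)) * F k := by
          conv_lhs => rw [← hFr, ← hFl]
          simp only [Matrix.mul_assoc, hFl]
      _ = c • 1 := by
          rw [hc, Matrix.mul_smul, Matrix.smul_mul, hFr, hF2]
  · intro k i j
    rw [Matrix.conjTranspose_mul, Matrix.mul_assoc, ← Matrix.mul_assoc (F k), hF1,
      ← Matrix.mul_assoc, hv4]
    exact mul_mem (hvM k i) (star_mem (hvM k j))
  · simp only [hWW]
    have h7 (k) : ∑ i, (((g k i : S)) : Matrix ι ι ℂ) =
        ∑ e : S with Quotient.mk r e = q k, (e : Matrix ι ι ℂ) := by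
      rw [(g k).sum_comp (fun e : {e : S // Quotient.mk r e = q k} => ((e : S) : Matrix ι ι ℂ))]
      exact (Finset.sum_subtype _ (by simp) _).symm
    simp only [h7]
    rw [q.sum_comp (fun k => ∑ e : S with Quotient.mk r e = k, (e : Matrix ι ι ℂ)),
      Finset.sum_fiberwise, Finset.sum_coe_sort S (fun e => e), hsum]
  · refine ⟨_, _, l, V, fun k => ?_, fun k => ?_, hV⟩
    · exact Fintype.card_pos_iff.2 ⟨⟨(q k).out, (q k).out_eq⟩⟩
    · refine Nat.pos_of_ne_zero fun h0 => (hrep k).ne_zero ?_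
      have : IsEmpty (Fin (l k)) := by rw [h0]; infer_instance
      rw [← hF1]
      ext x y
      simp [Matrix.mul_apply]

end Structure

/-! ### Arithmetic of block-diagonal matrices and the coisometries onto the blocks. -/

section DirectSum

variable {K n : ℕ} {N : Fin K → ℕ} (h : ∑ k, N k = n)

theorem directSum_apply (B : ∀ k, Matrix (Fin (N k)) (Fin (N k)) ℂ) (s t : Σ k, Fin (N k)) :
    directSum h B (finCongr h (finSigmaFinEquiv s)) (finCongr h (finSigmaFinEquiv t)) =
      Matrix.blockDiagonal' B s t := by
  simp [directSum]

theorem directSum_ext {X Y : Matrix (Fin n) (Fin n) ℂ}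
    (hXY : ∀ s t : Σ k, Fin (N k),
      X (finCongr h (finSigmaFinEquiv s)) (finCongr h (finSigmaFinEquiv t)) =
        Y (finCongr h (finSigmaFinEquiv s)) (finCongr h (finSigmaFinEquiv t))) : X = Y := by
  ext x y
  obtain ⟨s, rfl⟩ := (finSigmaFinEquiv.trans (finCongr h)).surjective x
  obtain ⟨t, rfl⟩ := (finSigmaFinEquiv.trans (finCongr h)).surjective y
  exact hXY s t

theorem directSum_injective :
    Function.Injective (directSum h) := fun _ _ hBC =>
  Matrix.blockDiagonal'_injective ((Matrix.reindex _ _).injective hBC)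

theorem directSum_mul (B C : ∀ k, Matrix (Fin (N k)) (Fin (N k)) ℂ) :
    directSum h B * directSum h C = directSum h (fun k => B k * C k) := by
  simp only [directSum, Matrix.reindex_apply, Matrix.submatrix_mul_equiv,
    Matrix.blockDiagonal'_mul]

theorem directSum_sub (B C : ∀ k, Matrix (Fin (N k)) (Fin (N k)) ℂ) :
    directSum h B - directSum h C = directSum h (B - C) := by
  simp only [directSum, Matrix.reindex_apply, Matrix.blockDiagonal'_sub]
  rfl

theorem directSum_zero : directSum h (0 : ∀ k, Matrix (Fin (N k)) (Fin (N k)) ℂ) = 0 := by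
  simp only [directSum, Matrix.reindex_apply, Matrix.blockDiagonal'_zero]
  rfl

theorem directSum_star (B : ∀ k, Matrix (Fin (N k)) (Fin (N k)) ℂ) :
    star (directSum h B) = directSum h (fun k => (B k)ᴴ) := by
  simp only [directSum, Matrix.reindex_apply, Matrix.star_eq_conjTranspose,
    Matrix.conjTranspose_submatrix, Matrix.blockDiagonal'_conjTranspose]

theorem trace_directSum (B : ∀ k, Matrix (Fin (N k)) (Fin (N k)) ℂ) :
    (directSum h B).trace = ∑ k, (B k).trace := by
  rw [Matrix.trace, ← (finSigmaFinEquiv.trans (finCongr h)).sum_comp, Fintype.sum_sigma]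
  refine Finset.sum_congr rfl fun k _ => Finset.sum_congr rfl fun i _ => ?_
  exact (directSum_apply h B _ _).trans (Matrix.blockDiagonal'_apply_eq B k i i)

theorem posSemidef_of_directSum {B : ∀ k, Matrix (Fin (N k)) (Fin (N k)) ℂ}
    (hB : (directSum h B).PosSemidef) (k : Fin K) : (B k).PosSemidef := by
  have h1 := hB.submatrix fun i : Fin (N k) => finCongr h (finSigmaFinEquiv ⟨k, i⟩)
  convert h1 using 1
  ext i j
  rw [Matrix.submatrix_apply, directSum_apply, Matrix.blockDiagonal'_apply_eq]

theorem isStarProjection_directSum {B : ∀ k, Matrix (Fin (N k)) (Fin (N k)) ℂ}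
    (hB : ∀ k, IsStarProjection (B k)) : IsStarProjection (directSum h B) := by
  refine ⟨?_, ?_⟩
  · rw [IsIdempotentElem, directSum_mul]
    exact congrArg _ (funext fun k => (hB k).isIdempotentElem)
  · rw [IsSelfAdjoint, directSum_star]
    exact congrArg _ (funext fun k => (hB k).isSelfAdjoint)

/-- The coisometry from `ℂ^n` onto its `k`-th block. -/
def blockProj (k : Fin K) : Matrix (Fin (N k)) (Fin n) ℂ :=
  (1 : Matrix (Fin n) (Fin n) ℂ).submatrix (fun i => finCongr h (finSigmaFinEquiv ⟨k, i⟩)) id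

theorem blockProj_mul {κ : Type*} (k : Fin K) (X : Matrix (Fin n) κ ℂ) :
    blockProj h k * X = X.submatrix (fun i => finCongr h (finSigmaFinEquiv ⟨k, i⟩)) id := by
  conv_lhs => rw [← Matrix.submatrix_id_id X]
  rw [blockProj, ← Matrix.submatrix_mul _ _ _ _ _ Function.bijective_id, Matrix.one_mul]

theorem blockProj_mul_mul (k : Fin K) (B : ∀ k, Matrix (Fin (N k)) (Fin (N k)) ℂ) :
    blockProj h k * directSum h B * (blockProj h k)ᴴ = B k := by
  rw [blockProj_mul, blockProj, Matrix.conjTranspose_submatrix, Matrix.conjTranspose_one,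
    ← Matrix.submatrix_mul _ _ _ _ _ Function.bijective_id, Matrix.mul_one]
  ext i j
  rw [Matrix.submatrix_apply, directSum_apply, Matrix.blockDiagonal'_apply_eq]

theorem blockProj_mul_conjTranspose (k : Fin K) : blockProj h k * (blockProj h k)ᴴ = 1 := by
  rw [blockProj_mul, blockProj, Matrix.conjTranspose_submatrix, Matrix.conjTranspose_one]
  ext i j
  simp [Matrix.one_apply]

/-- Identifies the initial projection of the coisometry; after composition with `U` it becomes the
central projection `P k`, as unitary equivalence on its range requires. -/
theorem conjTranspose_mul_blockProj (k : Fin K) :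
    (blockProj h k)ᴴ * blockProj h k = directSum h (Pi.single k 1) := by
  refine directSum_ext h ?_
  rintro ⟨k₁, i⟩ ⟨k₂, j⟩
  rw [directSum_apply, Matrix.mul_apply]
  simp only [blockProj, Matrix.conjTranspose_apply, Matrix.submatrix_apply, Matrix.one_apply,
    EmbeddingLike.apply_eq_iff_eq, id]
  by_cases hk : k₁ = k₂
  · subst hk
    rw [Matrix.blockDiagonal'_apply_eq]
    by_cases hk : k = k₁
    · subst hk
      simp [Matrix.one_apply, eq_comm]
    · simp [Ne.symm hk, hk]
  · rw [Matrix.blockDiagonal'_apply_ne _ _ _ hk]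
    refine Finset.sum_eq_zero fun a _ => ?_
    by_cases h1 : k = k₁
    · have h2 : k ≠ k₂ := fun h2 => hk (h1.symm.trans h2)
      simp [h2]
    · simp [h1]

end DirectSum

/-! ### Tensor products with the identity, and their algebra as a factor. -/

section Tensor

variable {m l : ℕ}

theorem tensor_apply (A : Matrix (Fin m) (Fin m) ℂ) (B : Matrix (Fin l) (Fin l) ℂ) (s t) :
    tensor A B (tensorIndex m l s) (tensorIndex m l t) = A s.1 t.1 * B s.2 t.2 := by
  simp [tensor, Matrix.kroneckerMap_apply]

theorem tensor_mul (A C : Matrix (Fin m) (Fin m) ℂ) (B D : Matrix (Fin l) (Fin l) ℂ) :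
    tensor A B * tensor C D = tensor (A * C) (B * D) := by
  simp only [tensor, Matrix.reindex_apply, Matrix.submatrix_mul_equiv,
    Matrix.mul_kronecker_mul]

theorem tensor_conjTranspose (A : Matrix (Fin m) (Fin m) ℂ) (B : Matrix (Fin l) (Fin l) ℂ) :
    (tensor A B)ᴴ = tensor Aᴴ Bᴴ := by
  simp only [tensor, Matrix.reindex_apply, Matrix.conjTranspose_submatrix,
    Matrix.conjTranspose_kronecker]

theorem tensor_add (A C : Matrix (Fin m) (Fin m) ℂ) (B : Matrix (Fin l) (Fin l) ℂ) :
    tensor (A + C) B = tensor A B + tensor C B := by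
  simp only [tensor, Matrix.reindex_apply, Matrix.add_kronecker]
  rfl

theorem tensor_smul (c : ℂ) (A : Matrix (Fin m) (Fin m) ℂ) (B : Matrix (Fin l) (Fin l) ℂ) :
    tensor (c • A) B = c • tensor A B := by
  simp only [tensor, Matrix.reindex_apply, Matrix.smul_kronecker]
  rfl

theorem smul_tensor (c : ℂ) (A : Matrix (Fin m) (Fin m) ℂ) (B : Matrix (Fin l) (Fin l) ℂ) :
    tensor A (c • B) = c • tensor A B := by
  simp only [tensor, Matrix.reindex_apply, Matrix.kronecker_smul]
  rfl

theorem tensor_zero (B : Matrix (Fin l) (Fin l) ℂ) :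
    tensor (0 : Matrix (Fin m) (Fin m) ℂ) B = 0 := by
  simp only [tensor, Matrix.reindex_apply, Matrix.zero_kronecker]
  rfl

theorem tensor_one_one :
    tensor (1 : Matrix (Fin m) (Fin m) ℂ) (1 : Matrix (Fin l) (Fin l) ℂ) = 1 := by
  simp [tensor]

theorem trace_tensor (A : Matrix (Fin m) (Fin m) ℂ) (B : Matrix (Fin l) (Fin l) ℂ) :
    (tensor A B).trace = A.trace * B.trace := by
  rw [← Matrix.trace_kronecker, Matrix.trace, ← (tensorIndex m l).sum_comp]
  exact Finset.sum_congr rfl fun s _ => tensor_apply A B s s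

/-- With at least one copy present, the copy numbered `0` recovers `A`. This gives injectivity, and
later passes positivity from a block to its tensor factor. -/
theorem submatrix_tensor_one (hl : 0 < l) (A : Matrix (Fin m) (Fin m) ℂ) :
    (tensor A (1 : Matrix (Fin l) (Fin l) ℂ)).submatrix
      (fun i => tensorIndex m l (i, ⟨0, hl⟩)) (fun i => tensorIndex m l (i, ⟨0, hl⟩)) = A := by
  ext i j
  rw [Matrix.submatrix_apply, tensor_apply, Matrix.one_apply_eq, mul_one]

theorem tensor_one_injective (hl : 0 < l) :
    Function.Injective fun A : Matrix (Fin m) (Fin m) ℂ =>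
      tensor A (1 : Matrix (Fin l) (Fin l) ℂ) := fun A B hAB => by
  rw [← submatrix_tensor_one hl A, ← submatrix_tensor_one hl B, show tensor A 1 = tensor B 1
    from hAB]

theorem tensor_one_eq_directSum (A : Matrix (Fin m) (Fin m) ℂ) :
    tensor A (1 : Matrix (Fin l) (Fin l) ℂ) =
      directSum (sum_const_fin m l) (fun _ : Fin l => A) := by
  refine directSum_ext (sum_const_fin m l) ?_
  -- Both numberings send the pair to `i + m * a`, because the first tensor index runs fastest.
  have hidx (a : Fin l) (i : Fin m) :
      finCongr (sum_const_fin m l) (finSigmaFinEquiv ⟨a, i⟩) = tensorIndex m l (i, a) := by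
    ext
    simp [tensorIndex, finSigmaFinEquiv_apply, finProdFinEquiv, mul_comm, add_comm]
  rintro ⟨a, i⟩ ⟨b, j⟩
  rw [directSum_apply, hidx, hidx, tensor_apply]
  by_cases hab : a = b
  · subst hab
    simp
  · rw [Matrix.blockDiagonal'_apply_ne _ _ _ hab]
    simp [hab]

/-- The `*`-algebra `M_m(ℂ) ⊗ ℂ[1]`. -/
def tensorSubalgebra (m l : ℕ) : StarSubalgebra ℂ (Matrix (Fin (m * l)) (Fin (m * l)) ℂ) where
  carrier := {B | ∃ A : Matrix (Fin m) (Fin m) ℂ, B = tensor A 1}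
  mul_mem' := by
    rintro _ _ ⟨A, rfl⟩ ⟨B, rfl⟩
    exact ⟨A * B, by rw [tensor_mul, one_mul]⟩
  add_mem' := by
    rintro _ _ ⟨A, rfl⟩ ⟨B, rfl⟩
    exact ⟨A + B, (tensor_add A B 1).symm⟩
  algebraMap_mem' c := ⟨c • 1, by rw [tensor_smul, tensor_one_one, Algebra.algebraMap_eq_smul_one]⟩
  star_mem' := by
    rintro _ ⟨A, rfl⟩
    exact ⟨Aᴴ, by rw [Matrix.star_eq_conjTranspose, tensor_conjTranspose, Matrix.conjTranspose_one]⟩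

theorem exists_eq_smul_one_of_commute {A : Matrix (Fin m) (Fin m) ℂ}
    (hA : ∀ C : Matrix (Fin m) (Fin m) ℂ, C * A = A * C) : ∃ c : ℂ, A = c • 1 := by
  obtain ⟨c, hc⟩ := Matrix.mem_range_scalar_of_commute_single (M := A) fun i j _ => hA _
  exact ⟨c, by rw [← hc, Matrix.scalar_apply, Matrix.smul_one_eq_diagonal]⟩

/-- Commuting with every `C ⊗ 1` means that the first leg commutes with every matrix, hence is
scalar. -/
theorem isFactor_tensorSubalgebra (hl : 0 < l) : IsFactor (tensorSubalgebra m l) := by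
  rw [IsFactor, eq_bot_iff]
  intro x hx
  obtain ⟨A, hA⟩ := x.2
  obtain ⟨c, rfl⟩ := exists_eq_smul_one_of_commute (A := A) fun C => by
    have h1 := Subalgebra.mem_center_iff.1 hx ⟨tensor C 1, C, rfl⟩
    have h2 := congrArg Subtype.val h1
    change tensor C (1 : Matrix (Fin l) (Fin l) ℂ) * x.1 = x.1 * tensor C 1 at h2
    rw [hA, tensor_mul, tensor_mul] at h2
    exact tensor_one_injective hl (by simpa using h2)
  refine Algebra.mem_bot.2 ⟨c, Subtype.ext ?_⟩
  rw [hA, tensor_smul, tensor_one_one, ← Algebra.algebraMap_eq_smul_one]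
  rfl

end Tensor

/-! ### The structure theorem in standard coordinates. -/

theorem directSum_tensor {K n : ℕ} {m l : Fin K → ℕ} (h : ∑ k, m k * l k = n)
    (B : ∀ k, Matrix (Fin (m k)) (Fin (m k)) ℂ) (C : ∀ k, Matrix (Fin (l k)) (Fin (l k)) ℂ) :
    directSum h (fun k => tensor (B k) (C k)) =
      Matrix.reindex
        ((Equiv.sigmaCongrRight fun k => tensorIndex (m k) (l k)).trans
          (finSigmaFinEquiv.trans (finCongr h)))
        ((Equiv.sigmaCongrRight fun k => tensorIndex (m k) (l k)).trans
          (finSigmaFinEquiv.trans (finCongr h)))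
        (Matrix.blockDiagonal' fun k => B k ⊗ₖ C k) := by
  refine directSum_ext h ?_
  rintro ⟨k, i⟩ ⟨k', j⟩
  rw [directSum_apply]
  obtain ⟨s, rfl⟩ := (tensorIndex (m k) (l k)).surjective i
  obtain ⟨t, rfl⟩ := (tensorIndex (m k') (l k')).surjective j
  simp only [Matrix.reindex_apply, Matrix.submatrix_apply, Equiv.symm_trans_apply,
    Equiv.symm_apply_apply, Equiv.sigmaCongrRight_symm, Equiv.sigmaCongrRight_apply]
  by_cases hk : k = k'
  · subst hk
    rw [Matrix.blockDiagonal'_apply_eq, Matrix.blockDiagonal'_apply_eq, tensor_apply,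
      Matrix.kroneckerMap_apply]
  · rw [Matrix.blockDiagonal'_apply_ne _ _ _ hk, Matrix.blockDiagonal'_apply_ne _ _ _ hk]

/-- The structure theorem for `*`-algebras of `n × n` matrices. -/
theorem exists_unitary_directSum {n : ℕ} (M : StarSubalgebra ℂ (Matrix (Fin n) (Fin n) ℂ)) :
    ∃ (K : ℕ) (m l : Fin K → ℕ) (hn : ∑ k, m k * l k = n) (U : Matrix.unitaryGroup (Fin n) ℂ),
      (∀ k, 0 < m k) ∧ (∀ k, 0 < l k) ∧
      ∀ A, A ∈ M ↔ ∃ B : ∀ k, Matrix (Fin (m k)) (Fin (m k)) ℂ,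
        Unitary.conjStarAlgAut ℂ _ U A = directSum hn fun k => tensor (B k) 1 := by
  obtain ⟨K, m, l, V, hm, hl, hV1, hV2, hM⟩ := exists_unitary_blockDiagonal M
  have hn : ∑ k, m k * l k = n := by
    -- An invertible matrix has index types of equal cardinality, which is the dimension count.
    have := Matrix.square_of_invertible V Vᴴ hV2 hV1
    simpa using this.symm
  let e : (Σ k, Fin (m k) × Fin (l k)) ≃ Fin n :=
    (Equiv.sigmaCongrRight fun k => tensorIndex (m k) (l k)).trans
      (finSigmaFinEquiv.trans (finCongr hn))
  let U : Matrix (Fin n) (Fin n) ℂ := Vᴴ.submatrix e.symm id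
  have hU' : Uᴴ = V.submatrix id e.symm := by
    rw [Matrix.conjTranspose_submatrix, Matrix.conjTranspose_conjTranspose]
  have hU : U ∈ Matrix.unitaryGroup (Fin n) ℂ := by
    rw [Matrix.mem_unitaryGroup_iff, Matrix.star_eq_conjTranspose, hU',
      ← Matrix.submatrix_mul _ _ _ _ _ Function.bijective_id, hV1, Matrix.submatrix_one_equiv]
  refine ⟨K, m, l, hn, ⟨U, hU⟩, hm, hl, fun A => ?_⟩
  rw [hM]
  refine exists_congr fun B => ?_
  have h1 : Unitary.conjStarAlgAut ℂ _ ⟨U, hU⟩ A = Matrix.reindex e e (Vᴴ * A * V) := by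
    rw [Unitary.conjStarAlgAut_apply]
    change U * A * Uᴴ = _
    rw [hU', Matrix.reindex_apply, Matrix.submatrix_mul _ _ _ _ _ Function.bijective_id,
      Matrix.submatrix_mul _ _ _ _ _ Function.bijective_id, Matrix.submatrix_id_id]
  rw [h1, directSum_tensor]
  exact (Matrix.reindex e e).injective.eq_iff.symm

/-! ### Central projections in block form. -/

section CentralProjections

variable {K n : ℕ} {m l : Fin K → ℕ} {hn : ∑ k, m k * l k = n}
  {U : Matrix.unitaryGroup (Fin n) ℂ} {M : StarSubalgebra ℂ (Matrix (Fin n) (Fin n) ℂ)}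

theorem posSemidef_conjStarAlgAut {A : Matrix (Fin n) (Fin n) ℂ} (hA : A.PosSemidef) :
    (Unitary.conjStarAlgAut ℂ _ U A).PosSemidef :=
  hA.mul_mul_conjTranspose_same (U : Matrix (Fin n) (Fin n) ℂ)

theorem tensor_single_one (j k : Fin K) :
    tensor ((Pi.single k 1 : ∀ k, Matrix (Fin (m k)) (Fin (m k)) ℂ) j)
        (1 : Matrix (Fin (l j)) (Fin (l j)) ℂ) =
      (Pi.single k 1 : ∀ k, Matrix (Fin (m k * l k)) (Fin (m k * l k)) ℂ) j := by
  by_cases hjk : j = k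
  · subst hjk
    simp [tensor_one_one]
  · simp [hjk, tensor_zero]

theorem conj_symm_single_mem
    (hM : ∀ A, A ∈ M ↔ ∃ B : ∀ k, Matrix (Fin (m k)) (Fin (m k)) ℂ,
      Unitary.conjStarAlgAut ℂ _ U A = directSum hn fun k => tensor (B k) 1) (k : Fin K) :
    (Unitary.conjStarAlgAut ℂ _ U).symm (directSum hn (Pi.single k 1)) ∈ M :=
  (hM _).2 ⟨Pi.single k 1, by simp only [StarAlgEquiv.apply_symm_apply, tensor_single_one]⟩

/-- An element of `M` whose diagonal blocks are scalar is central. -/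
theorem mem_center_of_directSum_smul
    (hM : ∀ A, A ∈ M ↔ ∃ B : ∀ k, Matrix (Fin (m k)) (Fin (m k)) ℂ,
      Unitary.conjStarAlgAut ℂ _ U A = directSum hn fun k => tensor (B k) 1)
    {p : M} {c : Fin K → ℂ}
    (hp : Unitary.conjStarAlgAut ℂ _ U (p : Matrix (Fin n) (Fin n) ℂ) =
      directSum hn fun k => c k • 1) :
    p ∈ Subalgebra.center ℂ M := by
  rw [Subalgebra.mem_center_iff]
  intro A
  obtain ⟨B, hB⟩ := (hM A).1 A.2
  refine Subtype.ext (EquivLike.injective (Unitary.conjStarAlgAut ℂ _ U) ?_)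
  change Unitary.conjStarAlgAut ℂ _ U ((A : Matrix (Fin n) (Fin n) ℂ) * p) =
    Unitary.conjStarAlgAut ℂ _ U ((p : Matrix (Fin n) (Fin n) ℂ) * A)
  rw [map_mul, map_mul, hB, hp, directSum_mul, directSum_mul]
  simp

/-- A projection in the centre of `M` is a sum of units of blocks. -/
theorem exists_directSum_of_central_projection (hm : ∀ k, 0 < m k) (hl : ∀ k, 0 < l k)
    (hM : ∀ A, A ∈ M ↔ ∃ B : ∀ k, Matrix (Fin (m k)) (Fin (m k)) ℂ,
      Unitary.conjStarAlgAut ℂ _ U A = directSum hn fun k => tensor (B k) 1)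
    {p : M} (hp : IsStarProjection p) (hc : p ∈ Subalgebra.center ℂ M) :
    ∃ c : Fin K → ℂ, (∀ k, c k = 0 ∨ c k = 1) ∧
      Unitary.conjStarAlgAut ℂ _ U (p : Matrix (Fin n) (Fin n) ℂ) =
        directSum hn fun k => c k • 1 := by
  obtain ⟨B, hB⟩ := (hM p).1 p.2
  -- Centrality is tested on the element of `M` with `C` in block `k` and zero elsewhere.
  have hcomm (k) (C : Matrix (Fin (m k)) (Fin (m k)) ℂ) : C * B k = B k * C := by
    let X := (Unitary.conjStarAlgAut ℂ _ U).symm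
      (directSum hn fun j => tensor ((Pi.single k C : ∀ k, Matrix (Fin (m k)) (Fin (m k)) ℂ) j) 1)
    have hX : Unitary.conjStarAlgAut ℂ _ U X = directSum hn fun j =>
        tensor ((Pi.single k C : ∀ k, Matrix (Fin (m k)) (Fin (m k)) ℂ) j) 1 :=
      StarAlgEquiv.apply_symm_apply _ _
    have h1 : X * p = p * X :=
      congrArg Subtype.val (Subalgebra.mem_center_iff.1 hc ⟨X, (hM X).2 ⟨_, hX⟩⟩)
    have h2 := congrArg (Unitary.conjStarAlgAut ℂ _ U) h1
    rw [map_mul, map_mul, hX, hB, directSum_mul, directSum_mul] at h2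
    have h3 := congrFun (directSum_injective hn h2) k
    simp only [Pi.single_eq_same, tensor_mul, mul_one] at h3
    exact tensor_one_injective (hl k) h3
  choose c hc using fun k => exists_eq_smul_one_of_commute (hcomm k)
  have hp' : Unitary.conjStarAlgAut ℂ _ U (p : Matrix (Fin n) (Fin n) ℂ) =
      directSum hn fun k => c k • 1 := by
    rw [hB]
    refine congrArg _ (funext fun k => ?_)
    rw [hc, tensor_smul, tensor_one_one]
  refine ⟨c, fun k => ?_, hp'⟩
  have h1 : (p : Matrix (Fin n) (Fin n) ℂ) * p = p := congrArg Subtype.val hp.isIdempotentElem.eq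
  have h2 := congrArg (Unitary.conjStarAlgAut ℂ _ U) h1
  rw [map_mul, hp', directSum_mul] at h2
  have h3 := congrFun (directSum_injective hn h2) k
  let a : Fin (m k * l k) := ⟨0, Nat.mul_pos (hm k) (hl k)⟩
  have h4 : c k * c k = c k := by simpa using congrFun (congrFun h3 a) a
  rcases eq_or_ne (c k) 0 with h | h
  · exact Or.inl h
  · exact Or.inr (mul_right_cancel₀ h (by rw [h4, one_mul]))

theorem directSum_single_eq_smul (k : Fin K) :
    directSum hn (Pi.single k 1) =
      directSum hn fun j => (Pi.single k 1 : Fin K → ℂ) j • 1 := by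
  refine congrArg _ (funext fun j => ?_)
  by_cases hjk : j = k
  · subst hjk
    simp
  · simp [hjk]

theorem single_ne_zero_block (hm : ∀ k, 0 < m k) (hl : ∀ k, 0 < l k) (k : Fin K) :
    (1 : Matrix (Fin (m k * l k)) (Fin (m k * l k)) ℂ) ≠ 0 := by
  have : Nonempty (Fin (m k * l k)) := ⟨⟨0, Nat.mul_pos (hm k) (hl k)⟩⟩
  exact one_ne_zero

theorem isStarProjection_coe_iff {p : M} :
    IsStarProjection (p : Matrix (Fin n) (Fin n) ℂ) ↔ IsStarProjection p := by
  simp only [isStarProjection_iff, IsIdempotentElem, IsSelfAdjoint, Subtype.ext_iff]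
  rfl

theorem isStarProjection_conj_iff {A : Matrix (Fin n) (Fin n) ℂ} :
    IsStarProjection (Unitary.conjStarAlgAut ℂ _ U A) ↔ IsStarProjection A := by
  simp only [isStarProjection_iff, IsIdempotentElem, IsSelfAdjoint, ← map_mul, ← map_star,
    EmbeddingLike.apply_eq_iff_eq]

theorem _root_.IsStarProjection.posSemidef {p : Matrix (Fin n) (Fin n) ℂ}
    (hp : IsStarProjection p) : p.PosSemidef := by
  have h := Matrix.posSemidef_conjTranspose_mul_self p
  rwa [show pᴴ = p from hp.isSelfAdjoint, hp.isIdempotentElem.eq] at h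

/-- The minimal projections of the centre are the units of the blocks. -/
theorem isMinimalCentralProjection_iff (hm : ∀ k, 0 < m k) (hl : ∀ k, 0 < l k)
    (hM : ∀ A, A ∈ M ↔ ∃ B : ∀ k, Matrix (Fin (m k)) (Fin (m k)) ℂ,
      Unitary.conjStarAlgAut ℂ _ U A = directSum hn fun k => tensor (B k) 1) {p : M} :
    IsMinimalCentralProjection M p ↔ ∃ k,
      Unitary.conjStarAlgAut ℂ _ U (p : Matrix (Fin n) (Fin n) ℂ) =
        directSum hn (Pi.single k 1) := by
  have hsingle (k : Fin K) : IsStarProjection (directSum hn (Pi.single k 1)) := by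
    refine isStarProjection_directSum hn fun j => ?_
    by_cases hjk : j = k
    · subst hjk
      simp
    · simp [hjk]
  have hne (k : Fin K) : directSum hn (Pi.single k 1) ≠ 0 := by
    rw [← directSum_zero hn]
    intro h0
    have h1 := congrFun (directSum_injective hn h0) k
    rw [Pi.single_eq_same] at h1
    exact single_ne_zero_block hm hl k h1
  constructor
  · rintro ⟨hp, hc, hp0, hmin⟩
    obtain ⟨c, hc01, hpc⟩ := exists_directSum_of_central_projection hm hl hM hp hc
    obtain ⟨k, hk⟩ : ∃ k, c k = 1 := by
      by_contra! hall
      have h0 : c = 0 := funext fun k => (hc01 k).resolve_right (hall k)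
      refine hp0 (Subtype.ext (EquivLike.injective (Unitary.conjStarAlgAut ℂ _ U) ?_))
      rw [hpc, ZeroMemClass.coe_zero, map_zero, ← directSum_zero hn, h0]
      exact congrArg _ (funext fun k => by simp)
    -- The unit of a block on which `p` is `1` lies below `p`, so minimality forces equality.
    let q : M := ⟨_, conj_symm_single_mem hM k⟩
    have hq : Unitary.conjStarAlgAut ℂ _ U (q : Matrix (Fin n) (Fin n) ℂ) =
      directSum hn (Pi.single k 1) := StarAlgEquiv.apply_symm_apply _ _
    refine ⟨k, ?_⟩
    have hpq := hmin q (isStarProjection_coe_iff.1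
        (isStarProjection_conj_iff.1 (hq ▸ hsingle k)))
      (mem_center_of_directSum_smul hM (hq.trans (directSum_single_eq_smul k))) (by
        refine (isStarProjection_conj_iff (U := U).1 ?_).posSemidef
        rw [map_sub, hpc, hq, directSum_sub]
        refine isStarProjection_directSum hn fun j => ?_
        by_cases hjk : j = k
        · subst hjk
          simp [hk]
        · rcases hc01 j with h | h
          · simp [hjk, h]
          · simp [hjk, h])
    rcases hpq with h | h
    · rw [h, ZeroMemClass.coe_zero, map_zero] at hq
      exact absurd hq.symm (hne k)
    · rw [← h, hq]
  · rintro ⟨k, hp⟩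
    refine ⟨isStarProjection_coe_iff.1 (isStarProjection_conj_iff.1 (hp ▸ hsingle k)),
      mem_center_of_directSum_smul hM (hp.trans (directSum_single_eq_smul k)), ?_, ?_⟩
    · rintro rfl
      rw [ZeroMemClass.coe_zero, map_zero] at hp
      exact hne k hp.symm
    · intro q hq hqc hpq
      obtain ⟨c, hc01, hqd⟩ := exists_directSum_of_central_projection hm hl hM hq hqc
      have h1 := posSemidef_conjStarAlgAut (U := U) hpq
      rw [map_sub, hp, hqd, directSum_sub] at h1
      have h2 (j : Fin K) (hjk : j ≠ k) : c j = 0 := by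
        refine (hc01 j).resolve_right fun h => ?_
        -- If `q` were `1` on another block, the difference would have diagonal entry `-1` there.
        have h3 := (posSemidef_of_directSum hn h1 j).diag_nonneg
          (i := ⟨0, Nat.mul_pos (hm j) (hl j)⟩)
        simp [hjk, h] at h3
        exact absurd h3 (by norm_num)
      rcases hc01 k with h | h
      · left
        refine Subtype.ext (EquivLike.injective (Unitary.conjStarAlgAut ℂ _ U) ?_)
        rw [hqd, ZeroMemClass.coe_zero, map_zero, ← directSum_zero hn]
        refine congrArg _ (funext fun j => ?_)
        by_cases hjk : j = k
        · subst hjk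
          simp [h]
        · simp [h2 j hjk]
      · right
        refine Subtype.ext (EquivLike.injective (Unitary.conjStarAlgAut ℂ _ U) ?_)
        rw [hqd, hp]
        refine congrArg _ (funext fun j => ?_)
        by_cases hjk : j = k
        · subst hjk
          simp [h]
        · simp [h2 j hjk, hjk]

end CentralProjections

end MatrixProb

/-! ### Assembly: factors, corners and density matrices. -/

theorem mainTheorem6 (n : ℕ) (M : StarSubalgebra ℂ (Matrix (Fin n) (Fin n) ℂ)) :
    ∃ (K : ℕ) (P : Fin K → M) (m ℓ : Fin K → ℕ) (hn : ∑ k, m k * ℓ k = n)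
      (U : Matrix (Fin n) (Fin n) ℂ)
      (Mk : ∀ k, StarSubalgebra ℂ (Matrix (Fin (m k * ℓ k)) (Fin (m k * ℓ k)) ℂ)),
      -- the `P k` list the minimal projections of the centre of `M`, each exactly once
      Function.Injective P ∧
      (∀ p : M, IsMinimalCentralProjection M p ↔ ∃ k, P k = p) ∧
      -- block sizes: `n_k = m_k ℓ_k = tr P_k`
      (∀ k, 0 < m k ∧ 0 < ℓ k ∧
        (P k : Matrix (Fin n) (Fin n) ℂ).trace = ((m k * ℓ k : ℕ) : ℂ)) ∧
      -- `U M Uᴴ` is the direct sum of the factors `M_k = M_{m_k}(ℂ) ⊗ ℂ[I]`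
      U ∈ Matrix.unitaryGroup (Fin n) ℂ ∧
      (fun A => U * A * Uᴴ) '' (M : Set (Matrix (Fin n) (Fin n) ℂ)) =
        {X | ∃ B : ∀ k, Matrix (Fin (m k * ℓ k)) (Fin (m k * ℓ k)) ℂ,
          (∀ k, B k ∈ Mk k) ∧ X = directSum hn B} ∧
      (∀ k, IsFactor (Mk k) ∧
        (Mk k : Set (Matrix (Fin (m k * ℓ k)) (Fin (m k * ℓ k)) ℂ)) =
          {B | ∃ A : Matrix (Fin (m k)) (Fin (m k)) ℂ, B = tensor A 1} ∧
        UnitarilyEquivalent (P k : Matrix (Fin n) (Fin n) ℂ) (corner M (P k))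
          (Mk k : Set (Matrix (Fin (m k * ℓ k)) (Fin (m k * ℓ k)) ℂ)) ∧
        -- the `k`-th block is the one belonging to `P k`
        U * (P k : Matrix (Fin n) (Fin n) ℂ) * Uᴴ = directSum hn (Pi.single k 1)) ∧
      -- the density matrices of all states on `M`
      ∀ φ : M →ₗ[ℂ] ℂ, IsNormalizedState φ →
        ∀ R ∈ densityMatrices M, Represents R φ →
          ∃ (Rk : ∀ k, Matrix (Fin (m k * ℓ k)) (Fin (m k * ℓ k)) ℂ)
            (Rhat : ∀ k, Matrix (Fin (m k)) (Fin (m k)) ℂ),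
            U * R * Uᴴ = directSum hn Rk ∧
            ∀ k, (Rk k).PosSemidef ∧ (Rhat k).PosSemidef ∧
              Rk k = tensor (Rhat k) ((1 / (ℓ k : ℂ)) • 1) ∧
              Rk k = (1 / (ℓ k : ℂ)) •
                directSum (sum_const_fin (m k) (ℓ k)) (fun _ : Fin (ℓ k) => Rhat k) ∧
              φ (P k) = (R * (P k : Matrix (Fin n) (Fin n) ℂ)).trace ∧
              φ (P k) = ((P k : Matrix (Fin n) (Fin n) ℂ) * R * (P k)).trace ∧
              φ (P k) = (Rk k).trace ∧
              φ (P k) = (Rhat k).trace := by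
  obtain ⟨K, m, l, hn, U, hm, hl, hM⟩ := exists_unitary_directSum M
  have hconj (A : Matrix (Fin n) (Fin n) ℂ) :
      (U : Matrix (Fin n) (Fin n) ℂ) * A * (U : Matrix (Fin n) (Fin n) ℂ)ᴴ =
        Unitary.conjStarAlgAut ℂ _ U A := rfl
  have hUU : (U : Matrix (Fin n) (Fin n) ℂ)ᴴ * (U : Matrix (Fin n) (Fin n) ℂ) = 1 :=
    Unitary.coe_star_mul_self U
  have hUU' : (U : Matrix (Fin n) (Fin n) ℂ) * (U : Matrix (Fin n) (Fin n) ℂ)ᴴ = 1 :=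
    Unitary.coe_mul_star_self U
  have htr (A : Matrix (Fin n) (Fin n) ℂ) :
      (Unitary.conjStarAlgAut ℂ _ U A).trace = A.trace := by
    rw [← hconj, Matrix.trace_mul_comm, ← Matrix.mul_assoc, hUU, Matrix.one_mul]
  let P (k : Fin K) : M := ⟨_, conj_symm_single_mem hM k⟩
  have hP (k : Fin K) : Unitary.conjStarAlgAut ℂ _ U (P k : Matrix (Fin n) (Fin n) ℂ) =
      directSum hn (Pi.single k 1) := StarAlgEquiv.apply_symm_apply _ _
  have hPM (k : Fin K) : IsMinimalCentralProjection M (P k) :=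
    (isMinimalCentralProjection_iff hm hl hM).2 ⟨k, hP k⟩
  have hPP (k : Fin K) : (P k : Matrix (Fin n) (Fin n) ℂ) * P k = P k :=
    congrArg Subtype.val (hPM k).1.isIdempotentElem.eq
  have htrace (X : ∀ k, Matrix (Fin (m k * l k)) (Fin (m k * l k)) ℂ) (k : Fin K) :
      (directSum hn X * directSum hn (Pi.single k 1)).trace = (X k).trace := by
    rw [directSum_mul, trace_directSum, Finset.sum_eq_single k]
    · simp
    · intro j _ hjk
      simp [hjk]
    · simp
  refine ⟨K, P, m, l, hn, U, fun k => tensorSubalgebra (m k) (l k), ?_, fun p => ?_, fun k => ?_,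
    U.2, ?_, fun k => ⟨isFactor_tensorSubalgebra (hl k), rfl, ?_, hP k⟩, fun φ _ R hR hRφ => ?_⟩
  · intro j k hjk
    have h1 := hP j
    rw [hjk, hP k] at h1
    have h2 := congrFun (directSum_injective hn h1) k
    by_contra hne
    rw [Pi.single_eq_same, Pi.single_eq_of_ne (Ne.symm hne)] at h2
    exact single_ne_zero_block hm hl k h2
  · rw [isMinimalCentralProjection_iff hm hl hM]
    refine exists_congr fun k => ?_
    rw [← hP k, EmbeddingLike.apply_eq_iff_eq, ← Subtype.ext_iff, eq_comm]
  · refine ⟨hm k, hl k, ?_⟩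
    rw [← htr, hP k, trace_directSum, Finset.sum_eq_single k]
    · simp
    · intro j _ hjk
      simp [hjk]
    · simp
  · ext X
    constructor
    · rintro ⟨A, hA, rfl⟩
      obtain ⟨B, hB⟩ := (hM A).1 hA
      exact ⟨fun k => tensor (B k) 1, fun k => ⟨B k, rfl⟩, hB⟩
    · rintro ⟨C, hC, rfl⟩
      choose B hB using hC
      refine ⟨(Unitary.conjStarAlgAut ℂ _ U).symm (directSum hn C), (hM _).2 ⟨B, ?_⟩,
        (hconj _).trans (StarAlgEquiv.apply_symm_apply _ _)⟩
      rw [StarAlgEquiv.apply_symm_apply]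
      exact congrArg _ (funext hB)
  · have hW : (blockProj hn k * (U : Matrix (Fin n) (Fin n) ℂ))ᴴ *
        (blockProj hn k * (U : Matrix (Fin n) (Fin n) ℂ)) = P k := by
      refine EquivLike.injective (Unitary.conjStarAlgAut ℂ _ U) ?_
      rw [hP, ← hconj, ← conjTranspose_mul_blockProj, Matrix.conjTranspose_mul]
      calc _ = ((U : Matrix (Fin n) (Fin n) ℂ) * (U : Matrix (Fin n) (Fin n) ℂ)ᴴ) *
            ((blockProj hn k)ᴴ * blockProj hn k) *
            ((U : Matrix (Fin n) (Fin n) ℂ) * (U : Matrix (Fin n) (Fin n) ℂ)ᴴ) := by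
            simp only [Matrix.mul_assoc]
        _ = _ := by rw [hUU', Matrix.one_mul, Matrix.mul_one]
    have hWW : blockProj hn k * (U : Matrix (Fin n) (Fin n) ℂ) *
        (blockProj hn k * (U : Matrix (Fin n) (Fin n) ℂ))ᴴ = 1 := by
      rw [Matrix.conjTranspose_mul, Matrix.mul_assoc, ← Matrix.mul_assoc _ _ (blockProj hn k)ᴴ,
        hUU', Matrix.one_mul, blockProj_mul_conjTranspose]
    refine ⟨blockProj hn k * (U : Matrix (Fin n) (Fin n) ℂ), hW, hWW, ?_⟩
    -- The partial isometry absorbs its initial projection `P k`, so the corner of `A` goes to the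
    -- `k`-th diagonal block of the conjugated `A`.
    have hcorner (A : Matrix (Fin n) (Fin n) ℂ) :
        blockProj hn k * (U : Matrix (Fin n) (Fin n) ℂ) * ((P k : Matrix (Fin n) (Fin n) ℂ) * A *
          (P k : Matrix (Fin n) (Fin n) ℂ)) *
          (blockProj hn k * (U : Matrix (Fin n) (Fin n) ℂ))ᴴ =
        blockProj hn k * Unitary.conjStarAlgAut ℂ _ U A * (blockProj hn k)ᴴ := by
      generalize hV : blockProj hn k * (U : Matrix (Fin n) (Fin n) ℂ) = V at hW hWW
      have h1 : V * (P k : Matrix (Fin n) (Fin n) ℂ) = V := by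
        rw [← hW, ← Matrix.mul_assoc, hWW, Matrix.one_mul]
      have h2 : (P k : Matrix (Fin n) (Fin n) ℂ) * Vᴴ = Vᴴ := by
        rw [← hW, Matrix.mul_assoc, hWW, Matrix.mul_one]
      rw [← Matrix.mul_assoc, ← Matrix.mul_assoc, h1, Matrix.mul_assoc _ _ Vᴴ, h2, ← hV, ← hconj,
        Matrix.conjTranspose_mul]
      simp only [Matrix.mul_assoc]
    ext X
    constructor
    · rintro ⟨A, rfl⟩
      let Y := (Unitary.conjStarAlgAut ℂ _ U).symm
        (directSum hn fun j => tensor ((Pi.single k A : ∀ k, Matrix (Fin (m k)) (Fin (m k)) ℂ) j) 1)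
      have hY : Unitary.conjStarAlgAut ℂ _ U Y = directSum hn fun j =>
          tensor ((Pi.single k A : ∀ k, Matrix (Fin (m k)) (Fin (m k)) ℂ) j) 1 :=
        StarAlgEquiv.apply_symm_apply _ _
      refine ⟨_, ⟨Y, (hM Y).2 ⟨_, hY⟩, rfl⟩, ?_⟩
      refine (hcorner Y).trans ?_
      rw [hY, blockProj_mul_mul, Pi.single_eq_same]
    · rintro ⟨_, ⟨A, hA, rfl⟩, rfl⟩
      obtain ⟨B, hB⟩ := (hM A).1 hA
      refine ⟨B k, (hcorner A).trans ?_⟩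
      rw [hB, blockProj_mul_mul]
  · obtain ⟨hRM, hRpos, -⟩ := hR
    obtain ⟨B, hB⟩ := (hM R).1 hRM
    have hl0 (k : Fin K) : (l k : ℂ) ≠ 0 := Nat.cast_ne_zero.2 (hl k).ne'
    have hpos (k : Fin K) : (tensor (B k) (1 : Matrix (Fin (l k)) (Fin (l k)) ℂ)).PosSemidef := by
      have h1 := posSemidef_conjStarAlgAut (U := U) hRpos
      rw [hB] at h1
      exact posSemidef_of_directSum hn h1 k
    -- The factor `l k` offsets the normalisation `1 / l k` of the second leg and makes the trace of
    -- the small matrix equal that of the block.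
    refine ⟨fun k => tensor (B k) 1, fun k => (l k : ℂ) • B k, hB, fun k => ?_⟩
    have hφ : φ (P k) = (R * (P k : Matrix (Fin n) (Fin n) ℂ)).trace := hRφ (P k)
    have hφ' : φ (P k) = (tensor (B k) (1 : Matrix (Fin (l k)) (Fin (l k)) ℂ)).trace := by
      rw [hφ, ← htr, map_mul, hB, hP, htrace]
    refine ⟨hpos k, ?_, ?_, ?_, hφ, ?_, hφ', ?_⟩
    · have h1 := (hpos k).submatrix fun i => tensorIndex (m k) (l k) (i, ⟨0, hl k⟩)
      rw [submatrix_tensor_one] at h1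
      exact h1.smul (Nat.cast_nonneg (l k))
    · rw [tensor_smul, smul_tensor, smul_smul, mul_one_div_cancel (hl0 k), one_smul]
    · rw [← tensor_one_eq_directSum, tensor_smul, smul_smul, one_div_mul_cancel (hl0 k), one_smul]
    -- Cyclicity brings the two copies of `P k` together, and idempotence merges them.
    · rw [Matrix.trace_mul_cycle, hPP, Matrix.trace_mul_comm, hφ]
    · rw [hφ', trace_tensor, Matrix.trace_smul, Matrix.trace_one, Fintype.card_fin, smul_eq_mul,
        mul_comm]
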